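/- Let $a<b$ be real numbers and let $W=\{W(t):t\in[a,b]\}$ be a Brownian motion on $[a,b]$ (independent increments, $W(t)-W(s)\sim N(0,t-s)$ for $s\le t$, almost surely continuous paths, arbitrary starting value). Let $$H_1=\{h\in L_2[a,b]: h \text{ absolutely continuous},\ h'\in L_2[a,b],\ h(a)=h(b)=0\},$$ a Hilbert space with the inner product $\langle f,g\rangle_1=\int_a^b f g\,dt+\int_a^b f'g'\,dt$ and norm $\|\cdot\|_1$. For $f,h\in H_1$ put $$\varepsilon(f,h)=-\int_a^b f'h'\,dt+\int_a^b f\,h'\,W\,dt,$$ $$\varepsilon_1(f,h)=-\tfrac12\int_a^b f'h'\,dt+\tfrac12\int_a^b f\,h'\,W\,dt+\tfrac12\int_a^b f'\,h\,W\,dt,$$ $$\varepsilon_2(f,h)=-\tfrac12\int_a^b f'h'\,dt+\tfrac12\int_a^b f\,h'\,W\,dt-\tfrac12\int_a^b f'\,h\,W\,dt .$$ There are non-random constants $c,C>0$ such that, almost surely, the following holds. 1. $\varepsilon,\varepsilon_1,\varepsilon_2$ are bilinear forms on $H_1$ and $\varepsilon=\varepsilon_1+\varepsilon_2$. 2. $\varepsilon_1$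 is symmetric, lower semibounded (there is a constant $\kappa\in\mathbb R$, which may depend on the path of $W$, with $\varepsilon_1(f,f)\ge\kappa\|f\|_1^2$ for all $f\in H_1$), and closed: for each such $\kappa$, $H_1$ is complete in the norm $\|f\|_{\varepsilon_1}=[\varepsilon_1(f,f)+(1-\kappa)\|f\|_1^2]^{1/2}$. 3. $\varepsilon_2$ is not symmetric. It is bounded (there is a constant $K$, which may depend on the path of $W$, with $|\varepsilon_2(f,g)|\le K\|f\|_1\|g\|_1$ for all $f,g\in H_1$) and $|\varepsilon_2(f,f)|\le C\|f\|_1^2$ for all $f\in H_1$, and it is coercive: $|\varepsilon_2(f,f)|\ge c\|f\|_1^2$ for all $f\in H_1$. 4. There are bounded linear operators $L_1,L_2:H_1\to H_1$, with $L_1$ self-adjoint, such that for all $f,g\in H_1$ $$\varepsilon_1(f,g)=\langle L_1f,g\rangle_1,\qquad \varepsilon_2(f,g)=\langle L_2f,g\rangle_1,\qquad \varepsilon(f,g)=\langle (L_1+L_2)f,g\rangle_1 .$$ -/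

import Mathlib

open MeasureTheory Filter Topology

/-- The vector space of real functions on `[a, b]` that are absolutely continuous, vanish at `a`
and at `b`, and have a derivative in `L²[a, b]`. Such a function is represented by its extension
by zero to the real line, so that two elements are equal iff they agree on `[a, b]`. -/
def h1Submodule (a b : ℝ) : Submodule ℝ (ℝ → ℝ) where
  carrier := {f | AbsolutelyContinuousOnInterval f a b ∧
    MemLp (deriv f) 2 (volume.restrict (Set.Ioc a b)) ∧ f a = 0 ∧ f b = 0 ∧
    ∀ x, x ∉ Set.Icc a b → f x = 0}
  zero_mem' := by
    refine ⟨?_, ?_, rfl, rfl, fun _ _ => rfl⟩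
    · exact (contDiffOn_const (c := (0 : ℝ))).absolutelyContinuousOnInterval
    · have : deriv (0 : ℝ → ℝ) = fun _ => 0 := by
        funext x; exact deriv_const x (0 : ℝ)
      rw [this]
      exact MemLp.zero'
  add_mem' := by
    rintro f g ⟨hf, hf2, hfa, hfb, hf0⟩ ⟨hg, hg2, hga, hgb, hg0⟩
    refine ⟨hf.add hg, ?_, by simp [hfa, hga], by simp [hfb, hgb], fun x hx => by
      simp [hf0 x hx, hg0 x hx]⟩
    refine (memLp_congr_ae ?_).2 (hf2.add hg2)
    rw [EventuallyEq, ae_restrict_iff' measurableSet_Ioc]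
    filter_upwards [hf.ae_differentiableAt, hg.ae_differentiableAt] with x h1 h2 hx
    have hx' : x ∈ Set.uIcc a b := Set.Icc_subset_uIcc (Set.Ioc_subset_Icc_self hx)
    exact deriv_add (h1 hx') (h2 hx')
  smul_mem' := by
    rintro c f ⟨hf, hf2, hfa, hfb, hf0⟩
    refine ⟨hf.const_mul c, ?_, by simp [hfa], by simp [hfb], fun x hx => by simp [hf0 x hx]⟩
    refine (memLp_congr_ae ?_).2 (hf2.const_smul c)
    rw [EventuallyEq, ae_restrict_iff' measurableSet_Ioc]
    filter_upwards [hf.ae_differentiableAt] with x h1 hx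
    have hx' : x ∈ Set.uIcc a b := Set.Icc_subset_uIcc (Set.Ioc_subset_Icc_self hx)
    exact deriv_const_smul c (h1 hx')

/-- The Sobolev space `H₁` on `[a, b]` with Dirichlet boundary conditions. -/
def H1 (a b : ℝ) : Type := h1Submodule a b

namespace H1

variable {a b : ℝ}

instance : AddCommGroup (H1 a b) := inferInstanceAs (AddCommGroup (h1Submodule a b))

instance : Module ℝ (H1 a b) := inferInstanceAs (Module ℝ (h1Submodule a b))

instance : FunLike (H1 a b) ℝ ℝ where
  coe f := Subtype.val (p := fun g => g ∈ h1Submodule a b) f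
  coe_injective := Subtype.val_injective

theorem ext_fun {f g : H1 a b} (h : ∀ x, f x = g x) : f = g := DFunLike.ext f g h

theorem apply_left (f : H1 a b) : f a = 0 := f.2.2.2.1

theorem apply_right (f : H1 a b) : f b = 0 := f.2.2.2.2.1

theorem apply_of_notMem (f : H1 a b) {x : ℝ} (hx : x ∉ Set.Icc a b) : f x = 0 :=
  f.2.2.2.2.2 x hx

theorem ac (f : H1 a b) : AbsolutelyContinuousOnInterval f a b := f.2.1

theorem memLp_deriv (f : H1 a b) : MemLp (deriv f) 2 (volume.restrict (Set.Ioc a b)) := f.2.2.1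

theorem coe_add (f g : H1 a b) (x : ℝ) : (f + g) x = f x + g x := rfl

theorem coe_smul (c : ℝ) (f : H1 a b) (x : ℝ) : (c • f) x = c * f x := rfl

theorem deriv_add_ae (f g : H1 a b) :
    deriv (f + g : H1 a b) =ᵐ[volume.restrict (Set.Ioc a b)] fun x => deriv f x + deriv g x := by
  rw [EventuallyEq, ae_restrict_iff' measurableSet_Ioc]
  filter_upwards [f.ac.ae_differentiableAt, g.ac.ae_differentiableAt] with x h1 h2 hx
  have hx' : x ∈ Set.uIcc a b := Set.Icc_subset_uIcc (Set.Ioc_subset_Icc_self hx)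
  exact deriv_add (h1 hx') (h2 hx')

theorem deriv_smul_ae (c : ℝ) (f : H1 a b) :
    deriv (c • f : H1 a b) =ᵐ[volume.restrict (Set.Ioc a b)] fun x => c * deriv f x := by
  rw [EventuallyEq, ae_restrict_iff' measurableSet_Ioc]
  filter_upwards [f.ac.ae_differentiableAt] with x h1 hx
  have hx' : x ∈ Set.uIcc a b := Set.Icc_subset_uIcc (Set.Ioc_subset_Icc_self hx)
  exact deriv_const_smul c (h1 hx')

theorem memLp_coe (f : H1 a b) : MemLp f 2 (volume.restrict (Set.Ioc a b)) := by
  obtain ⟨C, hC⟩ := f.ac.exists_bound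
  have hsub : Set.Ioc a b ⊆ Set.uIcc a b :=
    Set.Ioc_subset_Icc_self.trans Set.Icc_subset_uIcc
  refine MemLp.of_bound ((f.ac.continuousOn.mono hsub).aestronglyMeasurable measurableSet_Ioc) C ?_
  rw [ae_restrict_iff' measurableSet_Ioc]
  exact Eventually.of_forall fun x hx => hC x (hsub hx)

theorem eq_zero_of_le (h : b ≤ a) (f : H1 a b) : f = 0 := by
  refine ext_fun fun x => ?_
  by_cases hx : x ∈ Set.Icc a b
  · have : x = a := le_antisymm (hx.2.trans h) hx.1
    rw [this]; exact f.apply_left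
  · exact f.apply_of_notMem hx

/-- The inner product of `H₁`, before the instance is set up. -/
@[reducible] noncomputable def innerCore (a b : ℝ) : InnerProductSpace.Core ℝ (H1 a b) where
  inner f g := (∫ t in a..b, f t * g t) + ∫ t in a..b, deriv f t * deriv g t
  conj_inner_symm f g := by
    simp only [conj_trivial, mul_comm]
  re_inner_nonneg f := by
    rcases le_total a b with h | h
    · exact add_nonneg
        (intervalIntegral.integral_nonneg_of_forall h fun t => mul_self_nonneg _)
        (intervalIntegral.integral_nonneg_of_forall h fun t => mul_self_nonneg _)
    · rw [eq_zero_of_le h f]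
      have h0 : ∀ t, (0 : H1 a b) t = 0 := fun _ => rfl
      have h1 : ∀ t, deriv (0 : H1 a b) t = 0 := fun t => deriv_const t (0 : ℝ)
      simp [h0, h1]
  add_left f g k := by
    rcases le_total a b with h | h
    · simp only [intervalIntegral.integral_of_le h]
      have e1 : ∫ t in Set.Ioc a b, (f + g) t * k t
          = (∫ t in Set.Ioc a b, f t * k t) + ∫ t in Set.Ioc a b, g t * k t := by
        refine Eq.trans ?_ (integral_add (f.memLp_coe.integrable_mul k.memLp_coe)
          (g.memLp_coe.integrable_mul k.memLp_coe))
        exact integral_congr_ae (Eventually.of_forall fun t => by simp [coe_add, add_mul])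
      have e2 : ∫ t in Set.Ioc a b, deriv (f + g : H1 a b) t * deriv k t
          = (∫ t in Set.Ioc a b, deriv f t * deriv k t)
            + ∫ t in Set.Ioc a b, deriv g t * deriv k t := by
        refine Eq.trans ?_ (integral_add (f.memLp_deriv.integrable_mul k.memLp_deriv)
          (g.memLp_deriv.integrable_mul k.memLp_deriv))
        refine integral_congr_ae ?_
        filter_upwards [deriv_add_ae f g] with t ht
        simp [ht, add_mul]
      rw [e1, e2]; ring
    · have hk := eq_zero_of_le h k
      have h0 : ∀ t, k t = 0 := fun t => by rw [hk]; rfl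
      have h1 : ∀ t, deriv k t = 0 := fun t => by rw [hk]; exact deriv_const t (0 : ℝ)
      simp [h0, h1]
  smul_left f g c := by
    rcases le_total a b with h | h
    · simp only [intervalIntegral.integral_of_le h, conj_trivial]
      have e1 : ∫ t in Set.Ioc a b, (c • f) t * g t = c * ∫ t in Set.Ioc a b, f t * g t := by
        rw [← integral_const_mul]
        exact integral_congr_ae (Eventually.of_forall fun t => by simp [coe_smul, mul_assoc])
      have e2 : ∫ t in Set.Ioc a b, deriv (c • f : H1 a b) t * deriv g t
          = c * ∫ t in Set.Ioc a b, deriv f t * deriv g t := by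
        rw [← integral_const_mul]
        refine integral_congr_ae ?_
        filter_upwards [deriv_smul_ae c f] with t ht
        simp [ht, mul_assoc]
      rw [e1, e2]; ring
    · have hk := eq_zero_of_le h g
      have h0 : ∀ t, g t = 0 := fun t => by rw [hk]; rfl
      have h1 : ∀ t, deriv g t = 0 := fun t => by rw [hk]; exact deriv_const t (0 : ℝ)
      simp [h0, h1]
  definite f hf := by
    rcases lt_or_ge a b with h | h
    · have n1 : 0 ≤ ∫ t in a..b, f t * f t :=
        intervalIntegral.integral_nonneg_of_forall h.le fun t => mul_self_nonneg _
      have n2 : 0 ≤ ∫ t in a..b, deriv f t * deriv f t :=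
        intervalIntegral.integral_nonneg_of_forall h.le fun t => mul_self_nonneg _
      have z1 : ∫ t in a..b, f t * f t = 0 := by linarith
      have hc : ContinuousOn f (Set.Icc a b) := by
        have := f.ac.continuousOn
        rwa [Set.uIcc_of_le h.le] at this
      refine ext_fun fun x => ?_
      by_cases hx : x ∈ Set.Icc a b
      · by_contra hne
        have : 0 < ∫ t in a..b, f t * f t :=
          intervalIntegral.integral_pos h (hc.mul hc) (fun t _ => mul_self_nonneg _)
            ⟨x, hx, mul_self_pos.2 hne⟩
        exact this.ne' z1
      · exact f.apply_of_notMem hx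
    · exact eq_zero_of_le h f

noncomputable instance : NormedAddCommGroup (H1 a b) := (innerCore a b).toNormedAddCommGroup

noncomputable instance : InnerProductSpace ℝ (H1 a b) := InnerProductSpace.ofCore (innerCore a b).toCore

/-- The inner product `⟨f, g⟩₁ = ∫ f g + ∫ f' g'`. -/
theorem inner_def (f g : H1 a b) : inner ℝ f g =
    (∫ t in a..b, f t * g t) + ∫ t in a..b, deriv f t * deriv g t := rfl

theorem norm_sq_eq (f : H1 a b) : ‖f‖ ^ 2 =
    (∫ t in a..b, f t ^ 2) + ∫ t in a..b, deriv f t ^ 2 := by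
  rw [← real_inner_self_eq_norm_sq, inner_def]
  simp only [sq]

/-- The map `f ↦ f'` from `H₁` to `L²[a, b]`. -/
noncomputable def derivL2 (a b : ℝ) : H1 a b →ₗ[ℝ] Lp ℝ 2 (volume.restrict (Set.Ioc a b)) where
  toFun f := f.memLp_deriv.toLp (deriv f)
  map_add' f g := by
    rw [← MemLp.toLp_add, MemLp.toLp_eq_toLp_iff]
    exact deriv_add_ae f g
  map_smul' c f := by
    rw [RingHom.id_apply, ← MemLp.toLp_const_smul, MemLp.toLp_eq_toLp_iff]
    exact deriv_smul_ae c f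

theorem norm_derivL2_sq (hab : a ≤ b) (f : H1 a b) :
    ‖derivL2 a b f‖ ^ 2 = ∫ t in a..b, deriv f t ^ 2 := by
  rw [← real_inner_self_eq_norm_sq, L2.inner_def, intervalIntegral.integral_of_le hab]
  refine integral_congr_ae ?_
  filter_upwards [f.memLp_deriv.coeFn_toLp] with t ht
  change inner ℝ ((f.memLp_deriv.toLp (deriv f)) t) ((f.memLp_deriv.toLp (deriv f)) t) = _
  rw [ht]
  simp [sq]

theorem norm_derivL2_le (hab : a ≤ b) (f : H1 a b) : ‖derivL2 a b f‖ ≤ ‖f‖ := by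
  refine abs_le_of_sq_le_sq' ?_ (norm_nonneg _) |>.2
  rw [norm_derivL2_sq hab, norm_sq_eq]
  exact le_add_of_nonneg_left
    (intervalIntegral.integral_nonneg_of_forall hab fun t => sq_nonneg _)

theorem abs_le_derivL2 (hab : a ≤ b) (f : H1 a b) (x : ℝ) :
    |f x| ≤ (b - a) ^ (1 / 2 : ℝ) * ‖derivL2 a b f‖ := by
  by_cases hx : x ∈ Set.Icc a b
  · have h1 : f x = ∫ t in a..x, deriv f t := by
      have hac : AbsolutelyContinuousOnInterval f a x := by
        refine f.ac.mono ?_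
        rw [Set.uIcc_of_le hab, Set.uIcc_of_le hx.1]
        exact Set.Icc_subset_Icc_right hx.2
      rw [hac.integral_deriv_eq_sub, f.apply_left, sub_zero]
    have hfin : (volume.restrict (Set.Ioc a b)) (Set.Ioc a x) ≠ ⊤ := measure_ne_top _ _
    have h2 : inner ℝ (indicatorConstLp 2 measurableSet_Ioc hfin (1 : ℝ)) (derivL2 a b f)
        = f x := by
      rw [L2.inner_indicatorConstLp_one, h1, intervalIntegral.integral_of_le hx.1,
        Measure.restrict_restrict measurableSet_Ioc,
        Set.inter_eq_left.2 (Set.Ioc_subset_Ioc_right hx.2)]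
      refine integral_congr_ae ?_
      exact ae_restrict_of_ae_restrict_of_subset (Set.Ioc_subset_Ioc_right hx.2)
        f.memLp_deriv.coeFn_toLp
    rw [← h2]
    refine (abs_real_inner_le_norm _ _).trans ?_
    refine mul_le_mul_of_nonneg_right ?_ (norm_nonneg _)
    rw [norm_indicatorConstLp (by norm_num) (by norm_num)]
    simp only [norm_one, one_mul, ENNReal.toReal_ofNat]
    refine Real.rpow_le_rpow measureReal_nonneg ?_ (by norm_num)
    rw [measureReal_restrict_apply measurableSet_Ioc,
      Set.inter_eq_left.2 (Set.Ioc_subset_Ioc_right hx.2), Real.volume_real_Ioc_of_le hx.1]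
    linarith [hx.2]
  · rw [f.apply_of_notMem hx, abs_zero]
    exact mul_nonneg (Real.rpow_nonneg (by linarith) _) (norm_nonneg _)

theorem norm_le_derivL2 (hab : a ≤ b) (f : H1 a b) :
    ‖f‖ ≤ (b - a + 1) * ‖derivL2 a b f‖ := by
  refine abs_le_of_sq_le_sq' ?_ (mul_nonneg (by linarith) (norm_nonneg _)) |>.2
  have hc : IntervalIntegrable (fun t => f t ^ 2) volume a b :=
    (f.ac.continuousOn.pow 2).intervalIntegrable
  have h1 : ∫ t in a..b, f t ^ 2 ≤ ∫ _ in a..b, (b - a) * ‖derivL2 a b f‖ ^ 2 := by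
    refine intervalIntegral.integral_mono_on hab hc intervalIntegrable_const fun t _ => ?_
    have h2 := pow_le_pow_left₀ (abs_nonneg _) (abs_le_derivL2 hab f t) 2
    have h3 : ((b - a) ^ (1 / 2 : ℝ)) ^ 2 = b - a := by
      rw [← Real.sqrt_eq_rpow, Real.sq_sqrt (sub_nonneg.2 hab)]
    rwa [sq_abs, mul_pow, h3] at h2
  rw [intervalIntegral.integral_const, smul_eq_mul] at h1
  rw [norm_sq_eq, ← norm_derivL2_sq hab]
  nlinarith [mul_nonneg (sub_nonneg.2 hab) (sq_nonneg ‖derivL2 a b f‖)]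

theorem mem_range_derivL2 (hab : a ≤ b) (g : Lp ℝ 2 (volume.restrict (Set.Ioc a b))) 
    (hg : ∫ t in a..b, g t = 0) : ∃ f : H1 a b, derivL2 a b f = g := by
  have hgi : IntervalIntegrable g volume a b := by
    rw [intervalIntegrable_iff_integrableOn_Ioc_of_le hab]
    exact (Lp.memLp g).integrable (by norm_num)
  have hac := hgi.absolutelyContinuousOnInterval_intervalIntegral (c := a) Set.left_mem_uIcc
  let F : ℝ → ℝ := (Set.Icc a b).indicator fun x => ∫ t in a..x, g t
  have hF : ∀ x ∈ Set.Icc a b, F x = ∫ t in a..x, g t := fun x hx => Set.indicator_of_mem hx _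
  have hFac : AbsolutelyContinuousOnInterval F a b := by
    rw [← Set.uIcc_of_le hab] at hF
    rw [absolutelyContinuousOnInterval_iff] at hac ⊢
    intro ε hε
    obtain ⟨δ, hδ, h⟩ := hac ε hε
    refine ⟨δ, hδ, fun E hE hlen => ?_⟩
    refine lt_of_le_of_lt (le_of_eq ?_) (h E hE hlen)
    refine Finset.sum_congr rfl fun i hi => ?_
    rw [hF _ (hE.1 i hi).1, hF _ (hE.1 i hi).2]
  have hFd : deriv F =ᵐ[volume.restrict (Set.Ioc a b)] g := by
    have hb : ∀ᵐ x : ℝ, x ≠ b := by simp [ae_iff, measure_singleton]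
    rw [EventuallyEq, ae_restrict_iff' measurableSet_Ioc]
    filter_upwards [hgi.ae_hasDerivAt_integral, hb] with x h1 h2 hx
    have h3 := h1 (Set.Icc_subset_uIcc (Set.Ioc_subset_Icc_self hx)) a Set.left_mem_uIcc
    refine HasDerivAt.deriv (h3.congr_of_eventuallyEq ?_)
    filter_upwards [Ioo_mem_nhds hx.1 (lt_of_le_of_ne hx.2 h2)] with y hy
    exact hF y (Set.Ioo_subset_Icc_self hy)
  have hFm : F ∈ h1Submodule a b := by
    refine ⟨hFac, (memLp_congr_ae hFd).2 (Lp.memLp g), ?_, ?_, fun x hx =>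
      Set.indicator_of_notMem hx _⟩
    · rw [hF a (Set.left_mem_Icc.2 hab), intervalIntegral.integral_same]
    · rw [hF b (Set.right_mem_Icc.2 hab), hg]
  let f : H1 a b := ⟨F, hFm⟩
  exact ⟨f, Lp.ext (f.memLp_deriv.coeFn_toLp.trans hFd)⟩

instance : CompleteSpace (H1 a b) := by
  rcases le_total a b with hab | hab
  · have hlip : LipschitzWith 1 (derivL2 a b) :=
      AddMonoidHomClass.lipschitz_of_bound (derivL2 a b) 1 (fun f => by
        rw [one_mul]; exact norm_derivL2_le hab f) |>.weaken (by simp)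
    have hanti : AntilipschitzWith ⟨b - a + 1, by linarith⟩ (derivL2 a b) :=
      AddMonoidHomClass.antilipschitz_of_bound (derivL2 a b) fun f => norm_le_derivL2 hab f
    rw [completeSpace_iff_isComplete_range (hanti.isUniformInducing hlip.uniformContinuous)]
    have hfin : (volume.restrict (Set.Ioc a b)) Set.univ ≠ ⊤ := measure_ne_top _ _
    have hr : Set.range (derivL2 a b) =
        {g | inner ℝ (indicatorConstLp 2 MeasurableSet.univ hfin (1 : ℝ)) g = 0} := by
      ext g
      rw [Set.mem_ofPred_eq, L2.inner_indicatorConstLp_one, Measure.restrict_univ,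
        ← intervalIntegral.integral_of_le hab]
      refine ⟨?_, fun h => mem_range_derivL2 hab g h⟩
      rintro ⟨f, rfl⟩
      have h1 : ∫ t in a..b, (derivL2 a b f) t = ∫ t in a..b, deriv f t := by
        simp only [intervalIntegral.integral_of_le hab]
        exact integral_congr_ae f.memLp_deriv.coeFn_toLp
      rw [h1, f.ac.integral_deriv_eq_sub, f.apply_left, f.apply_right, sub_zero]
    rw [hr]
    exact (isClosed_eq (continuous_const.inner continuous_id) continuous_const).isComplete
  · have : Subsingleton (H1 a b) :=
      ⟨fun f g => by rw [eq_zero_of_le hab f, eq_zero_of_le hab g]⟩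
    infer_instance

end H1

/-- `W` is a Brownian motion on the time interval `[a, b]`: its increments over disjoint intervals
are independent, `W t - W s` is centred Gaussian with variance `t - s`, and almost every path is
continuous. The starting value `W a` is arbitrary, as in the restriction to `[a, b]` of a one-sided
or two-sided Brownian motion. -/
structure IsBrownianOn {Ω : Type*} [MeasurableSpace Ω] (a b : ℝ) (W : ℝ → Ω → ℝ)
    (P : Measure Ω) : Prop where
  aemeasurable : ∀ t ∈ Set.Icc a b, AEMeasurable (W t) P
  indep : ProbabilityTheory.HasIndepIncrements (fun t : Set.Icc a b => W t) P
  law : ∀ s ∈ Set.Icc a b, ∀ t ∈ Set.Icc a b, s ≤ t →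
    ProbabilityTheory.HasLaw (fun ω => W t ω - W s ω)
      (ProbabilityTheory.gaussianReal 0 (t - s).toNNReal) P
  cont : ∀ᵐ ω ∂P, ContinuousOn (fun t => W t ω) (Set.Icc a b)

/-- The bilinear form of the weak operator `f'' - w f' - w' f` along a path `w`. -/
noncomputable def formE {a b : ℝ} (w : ℝ → ℝ) (f h : H1 a b) : ℝ :=
  -(∫ t in a..b, deriv f t * deriv h t) + ∫ t in a..b, f t * deriv h t * w t

/-- The symmetric part `ε₁` of `formE w`. -/
noncomputable def formE1 {a b : ℝ} (w : ℝ → ℝ) (f h : H1 a b) : ℝ :=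
  -(1 / 2) * (∫ t in a..b, deriv f t * deriv h t)
    + (1 / 2) * (∫ t in a..b, f t * deriv h t * w t)
    + (1 / 2) * ∫ t in a..b, deriv f t * h t * w t

/-- The remaining part `ε₂` of `formE w`. -/
noncomputable def formE2 {a b : ℝ} (w : ℝ → ℝ) (f h : H1 a b) : ℝ :=
  -(1 / 2) * (∫ t in a..b, deriv f t * deriv h t)
    + (1 / 2) * (∫ t in a..b, f t * deriv h t * w t)
    - (1 / 2) * ∫ t in a..b, deriv f t * h t * w t

section Forms

variable {H : Type*} [NormedAddCommGroup H] [InnerProductSpace ℝ H]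

/-- The form `q` is symmetric. -/
def IsSymmForm (q : H → H → ℝ) : Prop := ∀ f g, q f g = q g f

/-- `C` is a lower bound of the form `q`, whose domain is all of `H`. -/
def IsFormLowerBound (q : H → H → ℝ) (C : ℝ) : Prop := ∀ f, C * ‖f‖ ^ 2 ≤ q f f

/-- The form `q` is lower semibounded. -/
def IsLowerSemibounded (q : H → H → ℝ) : Prop := ∃ C, IsFormLowerBound q C

/-- The form norm `(q(f, f) + (1 - C) ‖f‖²) ^ (1/2)` for a lower bound `C` of `q`. -/
noncomputable def formNorm (q : H → H → ℝ) (C : ℝ) (f : H) : ℝ :=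
  Real.sqrt (q f f + (1 - C) * ‖f‖ ^ 2)

/-- The lower semibounded form `q` is closed: its domain is complete in the form norm, for every
choice of the lower bound. -/
def IsClosedForm (q : H → H → ℝ) : Prop :=
  IsLowerSemibounded q ∧ ∀ C, IsFormLowerBound q C → ∀ u : ℕ → H,
    (∀ δ > 0, ∃ N, ∀ m ≥ N, ∀ n ≥ N, formNorm q C (u m - u n) < δ) →
      ∃ f, Tendsto (fun n => formNorm q C (u n - f)) atTop (𝓝 0)

/-- The form `q` is bounded. -/
def IsBoundedForm (q : H → H → ℝ) : Prop := ∃ K, ∀ f g, |q f g| ≤ K * ‖f‖ * ‖g‖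

end Forms

/-! The argument is pathwise. Let `w` be a continuous path, and let `D f = f'` and `M f = f w` be
viewed as maps from `H1 a b` to `L²`. `D` is a contraction, and `M` is bounded because `|f| ≤ √(b -
a) ‖f'‖` pointwise and `w` is bounded. Every integral in the forms is an `L²` inner product of such
images, so adjoints yield bounded representing operators (`formE1_eq_inner`, `formE2_eq_inner`). For
a form represented by a bounded operator on a complete space, each form norm is equivalent to the
original norm; boundedness, semiboundedness and closedness follow.

On the diagonal the two path integrals in `formE2` cancel, leaving `-‖f'‖² / 2` (`formE2_self`).
With `‖f'‖ ≤ ‖f‖ ≤ (b - a + 1) ‖f'‖` this gives coercivity constants free of the path.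

Asymmetry is tested on `f` and `h(t) = t f(t)`: the difference of the two values is `∫ f² w`
(`formE2_sub_swap`), nonzero for a bump `f` where `w` has a strict sign. Such a place exists almost
surely, since the increment `W b - W a` has no atom at zero. -/

/-! ### Forms represented by a bounded operator -/

section BoundedForms

variable {H : Type*} [NormedAddCommGroup H] [InnerProductSpace ℝ H] {q : H → H → ℝ}
  {T : H →L[ℝ] H}

theorem isBilinearMap_of_eq_inner (hq : ∀ f g, q f g = inner ℝ (T f) g) :
    IsBilinearMap ℝ q where
  add_left f g k := by simp only [hq, map_add, inner_add_left]
  smul_left c f g := by simp only [hq, map_smul, real_inner_smul_left, smul_eq_mul]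
  add_right f g k := by simp only [hq, inner_add_right]
  smul_right c f g := by simp only [hq, real_inner_smul_right, smul_eq_mul]

theorem abs_le_of_eq_inner (hq : ∀ f g, q f g = inner ℝ (T f) g) (f g : H) :
    |q f g| ≤ ‖T‖ * ‖f‖ * ‖g‖ := by
  rw [hq]
  exact (abs_real_inner_le_norm _ _).trans
    (mul_le_mul_of_nonneg_right (T.le_opNorm f) (norm_nonneg g))

theorem isLowerSemibounded_of_eq_inner (hq : ∀ f g, q f g = inner ℝ (T f) g) :
    IsLowerSemibounded q := by
  refine ⟨-‖T‖, fun f => ?_⟩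
  have h := neg_le_of_abs_le (abs_le_of_eq_inner hq f f)
  linarith [sq ‖f‖, mul_assoc ‖T‖ ‖f‖ ‖f‖, congrArg (‖T‖ * ·) (sq ‖f‖)]

/-- Since `q f f - C ‖f‖²` is nonnegative, the radicand is at least `‖f‖²`. Cauchy sequences for the
form norm are therefore Cauchy in norm. -/
theorem norm_le_formNorm {E : Type*} [NormedAddCommGroup E] {q : E → E → ℝ} {C : ℝ} (hC : IsFormLowerBound q C)
    (f : E) : ‖f‖ ≤ formNorm q C f := by
  refine Real.le_sqrt_of_sq_le ?_
  linarith [hC f]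

/-- The converse comparison: it turns norm convergence into convergence in the form norm. -/
theorem formNorm_le_of_eq_inner (hq : ∀ f g, q f g = inner ℝ (T f) g) (C : ℝ) (f : H) :
    formNorm q C f ≤ Real.sqrt (‖T‖ + |1 - C|) * ‖f‖ := by
  rw [formNorm, Real.sqrt_le_left (by positivity), mul_pow, Real.sq_sqrt (by positivity)]
  have h1 := le_of_abs_le (abs_le_of_eq_inner hq f f)
  have h2 := mul_le_mul_of_nonneg_right (le_abs_self (1 - C)) (sq_nonneg ‖f‖)
  linarith [congrArg (‖T‖ * ·) (sq ‖f‖), mul_assoc ‖T‖ ‖f‖ ‖f‖]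

theorem isClosedForm_of_eq_inner [CompleteSpace H] (hq : ∀ f g, q f g = inner ℝ (T f) g) :
    IsClosedForm q := by
  refine ⟨isLowerSemibounded_of_eq_inner hq, fun C hC u hu => ?_⟩
  have hcau : CauchySeq u := by
    rw [Metric.cauchySeq_iff]
    intro δ hδ
    obtain ⟨N, hN⟩ := hu δ hδ
    refine ⟨N, fun m hm n hn => ?_⟩
    rw [dist_eq_norm]
    exact (norm_le_formNorm hC _).trans_lt (hN m hm n hn)
  obtain ⟨f, hf⟩ := cauchySeq_tendsto_of_complete hcau
  refine ⟨f, squeeze_zero (fun n => Real.sqrt_nonneg _)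
    (fun n => formNorm_le_of_eq_inner hq C _) ?_⟩
  simpa using (tendsto_iff_norm_sub_tendsto_zero.1 hf).const_mul
    (Real.sqrt (‖T‖ + |1 - C|))

end BoundedForms

/-! ### Differentiation and multiplication by a path as bounded operators -/

namespace H1

variable {a b : ℝ}

/-- The map `f ↦ f'` as a bounded operator. -/
noncomputable def derivCLM (hab : a ≤ b) :
    H1 a b →L[ℝ] Lp ℝ 2 (volume.restrict (Set.Ioc a b)) :=
  (derivL2 a b).mkContinuous 1 fun f => by rw [one_mul]; exact norm_derivL2_le hab f

theorem derivCLM_coeFn (hab : a ≤ b) (f : H1 a b) :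
    derivCLM hab f =ᵐ[volume.restrict (Set.Ioc a b)] deriv f :=
  f.memLp_deriv.coeFn_toLp

theorem continuousOn (f : H1 a b) : ContinuousOn f (Set.Icc a b) :=
  f.ac.continuousOn.mono Set.Icc_subset_uIcc

theorem memLp_mul {w : ℝ → ℝ} (hw : ContinuousOn w (Set.Icc a b)) (f : H1 a b) :
    MemLp (fun t => f t * w t) 2 (volume.restrict (Set.Ioc a b)) := by
  obtain ⟨C, hC⟩ := isCompact_Icc.exists_bound_of_continuousOn (f.continuousOn.mul hw)
  refine MemLp.of_bound (((f.continuousOn.mul hw).mono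
    Set.Ioc_subset_Icc_self).aestronglyMeasurable measurableSet_Ioc) C ?_
  rw [ae_restrict_iff' measurableSet_Ioc]
  exact Eventually.of_forall fun x hx => hC x (Set.Ioc_subset_Icc_self hx)

/-- Multiplication by a continuous path, as a linear map from `H₁` to `L²[a, b]`. -/
noncomputable def mulL2 {w : ℝ → ℝ} (hw : ContinuousOn w (Set.Icc a b)) :
    H1 a b →ₗ[ℝ] Lp ℝ 2 (volume.restrict (Set.Ioc a b)) where
  toFun f := (memLp_mul hw f).toLp _
  map_add' f g := by
    rw [← MemLp.toLp_add, MemLp.toLp_eq_toLp_iff]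
    exact Eventually.of_forall fun t => by simp [coe_add, add_mul]
  map_smul' c f := by
    rw [RingHom.id_apply, ← MemLp.toLp_const_smul, MemLp.toLp_eq_toLp_iff]
    exact Eventually.of_forall fun t => by simp [coe_smul, mul_assoc]

/-- The sup norm of `f` is controlled by `‖f'‖`, hence by `‖f‖`, and the path is bounded on a
compact interval. -/
theorem exists_norm_mulL2_le (hab : a ≤ b) {w : ℝ → ℝ} (hw : ContinuousOn w (Set.Icc a b)) :
    ∃ K, ∀ f : H1 a b, ‖mulL2 hw f‖ ≤ K * ‖f‖ := by
  obtain ⟨C, hC⟩ := isCompact_Icc.exists_bound_of_continuousOn hw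
  have hC0 : 0 ≤ C := (norm_nonneg _).trans (hC a (Set.left_mem_Icc.2 hab))
  have hr : 0 ≤ (b - a) ^ (1 / 2 : ℝ) := Real.rpow_nonneg (sub_nonneg.2 hab) _
  have h := fun f : H1 a b => Lp.norm_le_of_ae_bound (f := mulL2 hw f)
    (C := (b - a) ^ (1 / 2 : ℝ) * ‖f‖ * C) (by positivity) (by
      filter_upwards [(memLp_mul hw f).coeFn_toLp, ae_restrict_mem measurableSet_Ioc] with t ht hx
      change ‖((memLp_mul hw f).toLp _) t‖ ≤ _
      rw [ht, norm_mul]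
      refine mul_le_mul ?_ (hC t (Set.Ioc_subset_Icc_self hx)) (norm_nonneg _) (by positivity)
      exact (abs_le_derivL2 hab f t).trans
        (mul_le_mul_of_nonneg_left (norm_derivL2_le hab f) hr))
  -- The measure factor is the cost of passing from a uniform bound to the `L²` norm.
  refine ⟨measureUnivNNReal (volume.restrict (Set.Ioc a b)) ^ (ENNReal.toReal 2)⁻¹
    * ((b - a) ^ (1 / 2 : ℝ) * C), fun f => (h f).trans (le_of_eq ?_)⟩
  ring

/-- Multiplication by a continuous path as a bounded operator from `H₁` to `L²[a, b]`. -/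
noncomputable def mulCLM (hab : a ≤ b) {w : ℝ → ℝ} (hw : ContinuousOn w (Set.Icc a b)) :
    H1 a b →L[ℝ] Lp ℝ 2 (volume.restrict (Set.Ioc a b)) :=
  (mulL2 hw).mkContinuousOfExistsBound (exists_norm_mulL2_le hab hw)

theorem mulCLM_coeFn (hab : a ≤ b) {w : ℝ → ℝ} (hw : ContinuousOn w (Set.Icc a b))
    (f : H1 a b) :
    mulCLM hab hw f =ᵐ[volume.restrict (Set.Ioc a b)] fun t => f t * w t :=
  (memLp_mul hw f).coeFn_toLp

theorem inner_derivCLM_derivCLM (hab : a ≤ b) (f h : H1 a b) :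
    inner ℝ (derivCLM hab f) (derivCLM hab h) = ∫ t in a..b, deriv f t * deriv h t := by
  rw [L2.inner_def, intervalIntegral.integral_of_le hab]
  refine integral_congr_ae ?_
  filter_upwards [derivCLM_coeFn hab f, derivCLM_coeFn hab h] with t h1 h2
  simp [h1, h2, mul_comm]

theorem inner_mulCLM_derivCLM (hab : a ≤ b) {w : ℝ → ℝ} (hw : ContinuousOn w (Set.Icc a b))
    (f h : H1 a b) :
    inner ℝ (mulCLM hab hw f) (derivCLM hab h) = ∫ t in a..b, f t * deriv h t * w t := by
  rw [L2.inner_def, intervalIntegral.integral_of_le hab]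
  refine integral_congr_ae ?_
  filter_upwards [mulCLM_coeFn hab hw f, derivCLM_coeFn hab h] with t h1 h2
  simp only [h1, h2, RCLike.inner_apply, conj_trivial]
  ring

theorem inner_derivCLM_mulCLM (hab : a ≤ b) {w : ℝ → ℝ} (hw : ContinuousOn w (Set.Icc a b))
    (f h : H1 a b) :
    inner ℝ (derivCLM hab f) (mulCLM hab hw h) = ∫ t in a..b, deriv f t * h t * w t := by
  rw [real_inner_comm, inner_mulCLM_derivCLM]
  simp only [mul_comm (deriv f _)]

/-! ### Representing operators and the diagonal of the second form -/

/-- The operator representing `formE1 w`. -/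
noncomputable def opE1 (hab : a ≤ b) {w : ℝ → ℝ} (hw : ContinuousOn w (Set.Icc a b)) :
    H1 a b →L[ℝ] H1 a b :=
  -(1 / 2 : ℝ) • (derivCLM hab).adjoint ∘L derivCLM hab
    + (1 / 2 : ℝ) • (derivCLM hab).adjoint ∘L mulCLM hab hw
    + (1 / 2 : ℝ) • (mulCLM hab hw).adjoint ∘L derivCLM hab

/-- The operator representing `formE2 w`. -/
noncomputable def opE2 (hab : a ≤ b) {w : ℝ → ℝ} (hw : ContinuousOn w (Set.Icc a b)) :
    H1 a b →L[ℝ] H1 a b :=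
  -(1 / 2 : ℝ) • (derivCLM hab).adjoint ∘L derivCLM hab
    + (1 / 2 : ℝ) • (derivCLM hab).adjoint ∘L mulCLM hab hw
    - (1 / 2 : ℝ) • (mulCLM hab hw).adjoint ∘L derivCLM hab

theorem formE1_eq_inner (hab : a ≤ b) {w : ℝ → ℝ} (hw : ContinuousOn w (Set.Icc a b))
    (f g : H1 a b) : formE1 w f g = inner ℝ (opE1 hab hw f) g := by
  simp [formE1, opE1, inner_add_left, real_inner_smul_left, inner_neg_left,
    ContinuousLinearMap.adjoint_inner_left, inner_derivCLM_derivCLM, inner_mulCLM_derivCLM,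
    inner_derivCLM_mulCLM]

theorem formE2_eq_inner (hab : a ≤ b) {w : ℝ → ℝ} (hw : ContinuousOn w (Set.Icc a b))
    (f g : H1 a b) : formE2 w f g = inner ℝ (opE2 hab hw f) g := by
  simp [formE2, opE2, inner_add_left, inner_sub_left, real_inner_smul_left, inner_neg_left,
    ContinuousLinearMap.adjoint_inner_left, inner_derivCLM_derivCLM, inner_mulCLM_derivCLM,
    inner_derivCLM_mulCLM]

theorem formE_eq_add (w : ℝ → ℝ) (f g : H1 a b) :
    formE w f g = formE1 w f g + formE2 w f g := by
  simp only [formE, formE1, formE2]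
  ring

theorem isSymmForm_formE1 (w : ℝ → ℝ) : IsSymmForm (formE1 w : H1 a b → H1 a b → ℝ) := by
  intro f g
  simp only [formE1, mul_comm (deriv f _), mul_comm (f _)]
  ring

theorem isSelfAdjoint_opE1 (hab : a ≤ b) {w : ℝ → ℝ} (hw : ContinuousOn w (Set.Icc a b)) :
    IsSelfAdjoint (opE1 hab hw) := by
  rw [ContinuousLinearMap.isSelfAdjoint_iff_isSymmetric]
  intro f g
  change inner ℝ (opE1 hab hw f) g = inner ℝ f (opE1 hab hw g)
  rw [← formE1_eq_inner, isSymmForm_formE1, formE1_eq_inner hab hw, real_inner_comm]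

/-- For equal arguments the two path integrals coincide and enter with opposite signs, so no trace
of `w` remains. -/
theorem formE2_self (hab : a ≤ b) (w : ℝ → ℝ) (f : H1 a b) :
    formE2 w f f = -(1 / 2) * ‖derivL2 a b f‖ ^ 2 := by
  rw [norm_derivL2_sq hab]
  simp only [formE2, mul_comm (deriv f _) (f _), sq]
  ring

theorem abs_formE2_self (hab : a ≤ b) (w : ℝ → ℝ) (f : H1 a b) :
    |formE2 w f f| = 1 / 2 * ‖derivL2 a b f‖ ^ 2 := by
  rw [formE2_self hab, neg_mul, abs_neg, abs_of_nonneg (by positivity)]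

/-! ### Failure of symmetry -/

/-- A `C¹` function vanishing outside `(a, b)` is an element of `H₁`. -/
theorem exists_of_contDiff {F : ℝ → ℝ} (hF : ContDiff ℝ 1 F) (ha : F a = 0) (hb : F b = 0)
    (hF0 : ∀ x, x ∉ Set.Icc a b → F x = 0) : ∃ f : H1 a b, (f : ℝ → ℝ) = F := by
  have hc : Continuous (deriv F) := hF.continuous_deriv le_rfl
  obtain ⟨C, hC⟩ := isCompact_Icc.exists_bound_of_continuousOn (s := Set.Icc a b) hc.continuousOn
  refine ⟨⟨F, hF.contDiffOn.absolutelyContinuousOnInterval,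
    MemLp.of_bound hc.aestronglyMeasurable C ?_, ha, hb, hF0⟩, rfl⟩
  rw [ae_restrict_iff' measurableSet_Ioc]
  exact Eventually.of_forall fun x hx => hC x (Set.Ioc_subset_Icc_self hx)

theorem intervalIntegral_bump_sq_mul_pos {w : ℝ → ℝ} {x : ℝ} (φ : ContDiffBump x)
    (hsub : Metric.ball x φ.rOut ⊆ Set.Ioo a b)
    (hw : ContinuousOn w (Set.Icc a b)) (hpos : ∀ t ∈ Metric.ball x φ.rOut, 0 < w t) :
    0 < ∫ t in a..b, φ t ^ 2 * w t := by
  have hx := hsub (Metric.mem_ball_self φ.rOut_pos)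
  refine intervalIntegral.integral_pos (hx.1.trans hx.2)
    ((φ.continuous.pow 2).continuousOn.mul hw) (fun t _ => ?_)
    ⟨x, Set.Ioo_subset_Icc_self hx, ?_⟩
  · by_cases ht : t ∈ Metric.ball x φ.rOut
    · exact mul_nonneg (sq_nonneg _) (hpos t ht).le
    · rw [φ.zero_of_le_dist (not_lt.1 ht)]
      simp
  · have h1 : φ x = 1 := φ.one_of_mem_closedBall (Metric.mem_closedBall_self φ.rIn_pos.le)
    rw [h1, one_pow, one_mul]
    exact hpos x (Metric.mem_ball_self φ.rOut_pos)

/-- Antisymmetrizing leaves `∫ (f h' - f' h) w`. The choice `h = t f` makes the bracket equal to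
`f²`, which has a sign. -/
theorem formE2_sub_swap (hab : a ≤ b) {w : ℝ → ℝ} (hw : ContinuousOn w (Set.Icc a b))
    {f h : H1 a b} (hf : Differentiable ℝ f) (hh : ∀ t, h t = t * f t) :
    formE2 w f h - formE2 w h f = ∫ t in a..b, f t ^ 2 * w t := by
  have hd : ∀ t, deriv h t = f t + t * deriv f t := fun t => by
    have e : (h : ℝ → ℝ) = fun t => t * f t := funext hh
    rw [e, deriv_fun_mul differentiableAt_fun_id (hf t), deriv_id'', one_mul]
  have hint : ∀ k l : H1 a b, IntervalIntegrable (fun t => k t * deriv l t * w t) volume a b := by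
    intro k l
    rw [intervalIntegrable_iff_integrableOn_Ioc_of_le hab]
    refine ((memLp_mul hw k).integrable_mul l.memLp_deriv).congr
      (Eventually.of_forall fun t => ?_)
    simp only [Pi.mul_apply]
    ring
  have key : (∫ t in a..b, f t * deriv h t * w t) - ∫ t in a..b, h t * deriv f t * w t
      = ∫ t in a..b, f t ^ 2 * w t := by
    rw [← intervalIntegral.integral_sub (hint f h) (hint h f)]
    refine intervalIntegral.integral_congr fun t _ => ?_
    simp only [hd, hh]
    ring
  have e1 : ∫ t in a..b, deriv f t * h t * w t = ∫ t in a..b, h t * deriv f t * w t := by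
    simp only [mul_comm (deriv f _)]
  have e2 : ∫ t in a..b, deriv h t * f t * w t = ∫ t in a..b, f t * deriv h t * w t := by
    simp only [mul_comm (deriv h _)]
  have e3 : ∫ t in a..b, deriv h t * deriv f t = ∫ t in a..b, deriv f t * deriv h t := by
    simp only [mul_comm (deriv h _)]
  rw [← key, formE2, formE2, e1, e2, e3]
  ring

theorem not_isSymmForm_formE2 {w : ℝ → ℝ} (hw : ContinuousOn w (Set.Icc a b))
    {x : ℝ} (hx : x ∈ Set.Ioo a b) (hwx : w x ≠ 0) :
    ¬ IsSymmForm (formE2 w : H1 a b → H1 a b → ℝ) := by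
  intro hsymm
  have hab : a ≤ b := (hx.1.trans hx.2).le
  have hcx : ContinuousAt w x := hw.continuousAt (Icc_mem_nhds hx.1 hx.2)
  -- Multiplying by the constant `w x` gives a weight positive near `x`, whatever the sign of `w x`.
  have hev : ∀ᶠ t in 𝓝 x, t ∈ Set.Ioo a b ∧ 0 < w x * w t :=
    (show ∀ᶠ t in 𝓝 x, t ∈ Set.Ioo a b from Ioo_mem_nhds hx.1 hx.2).and ((hcx.const_mul (w x)).eventually
      (lt_mem_nhds (mul_self_pos.2 hwx)))
  obtain ⟨r, hr, hball⟩ := Metric.eventually_nhds_iff_ball.1 hev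
  -- The outer radius `r` makes the bump vanish off the ball, hence off `(a, b)`; the inner radius
  -- only has to lie strictly between `0` and `r`.
  let φ : ContDiffBump x := ⟨r / 2, r, half_pos hr, half_lt_self hr⟩
  have h0 : ∀ t, t ∉ Set.Ioo a b → φ t = 0 := fun t ht =>
    φ.zero_of_le_dist (not_lt.1 fun hlt => ht (hball t hlt).1)
  have ha : φ a = 0 := h0 a fun h => lt_irrefl _ h.1
  have hb : φ b = 0 := h0 b fun h => lt_irrefl _ h.2
  have h1 : ∀ t, t ∉ Set.Icc a b → φ t = 0 := fun t ht =>
    h0 t fun h => ht (Set.Ioo_subset_Icc_self h)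
  obtain ⟨f, hf⟩ := exists_of_contDiff φ.contDiff ha hb h1
  obtain ⟨h, hh⟩ := exists_of_contDiff (F := fun t => t * φ t) (contDiff_id.mul φ.contDiff)
    (mul_eq_zero_of_right a ha) (mul_eq_zero_of_right b hb) fun t ht => by simp [h1 t ht]
  have hdiff : Differentiable ℝ f := hf ▸ (φ.contDiff (n := 1)).differentiable one_ne_zero
  have hswap := formE2_sub_swap hab hw hdiff fun t => by rw [hh, hf]
  rw [hsymm f h, sub_self, hf] at hswap
  have hp := intervalIntegral_bump_sq_mul_pos (w := fun t => w x * w t) φ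
    (fun t ht => (hball t ht).1) (continuousOn_const.mul hw) fun t ht => (hball t ht).2
  have e : (fun t => φ t ^ 2 * (w x * w t)) = fun t => w x * (φ t ^ 2 * w t) := by
    funext t; ring
  rw [e, intervalIntegral.integral_const_mul, ← hswap, mul_zero] at hp
  exact lt_irrefl _ hp

end H1

/-! ### Almost sure properties of the path and conclusion -/

/-- A path vanishing on the dense open interval would vanish at both endpoints by continuity. -/
theorem ContinuousOn.exists_mem_Ioo_ne_zero {a b : ℝ} (hab : a < b) {w : ℝ → ℝ}
    (hw : ContinuousOn w (Set.Icc a b)) (hne : w b - w a ≠ 0) :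
    ∃ x ∈ Set.Ioo a b, w x ≠ 0 := by
  by_contra! h
  have h0 : Set.EqOn w 0 (Set.Icc a b) :=
    Set.EqOn.of_subset_closure h hw continuousOn_const Set.Ioo_subset_Icc_self
      (closure_Ioo hab.ne).ge
  exact hne (by simp [h0 (Set.left_mem_Icc.2 hab.le), h0 (Set.right_mem_Icc.2 hab.le)])

/-- The increment is Gaussian with variance `b - a > 0`, so it does not charge points. -/
theorem IsBrownianOn.ae_sub_ne_zero {Ω : Type*} [MeasurableSpace Ω] {P : Measure Ω}
    {a b : ℝ} (hab : a < b) {W : ℝ → Ω → ℝ} (hW : IsBrownianOn a b W P) :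
    ∀ᵐ ω ∂P, W b ω - W a ω ≠ 0 := by
  have hlaw := hW.law a (Set.left_mem_Icc.2 hab.le) b (Set.right_mem_Icc.2 hab.le) hab.le
  have hv : (b - a).toNNReal ≠ 0 := (Real.toNNReal_pos.2 (sub_pos.2 hab)).ne'
  have := ProbabilityTheory.nullSingletonClass_gaussianReal (μ := 0) hv
  simp only [ae_iff, not_not]
  rw [hlaw.measure_eq (p := fun x => x = 0) (measurableSet_singleton 0)]
  exact measure_singleton 0

theorem mainTheorem7 {Ω : Type*} [MeasurableSpace Ω] (P : Measure Ω) [IsProbabilityMeasure P]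
    (a b : ℝ) (hab : a < b) (W : ℝ → Ω → ℝ) (hW : IsBrownianOn a b W P) :
    ∃ c C : ℝ, 0 < c ∧ 0 < C ∧ ∀ᵐ ω ∂P, ∀ (ε ε₁ ε₂ : H1 a b → H1 a b → ℝ),
      ε = formE (fun t => W t ω) → ε₁ = formE1 (fun t => W t ω) →
      ε₂ = formE2 (fun t => W t ω) →
      (IsBilinearMap ℝ ε ∧ IsBilinearMap ℝ ε₁ ∧ IsBilinearMap ℝ ε₂) ∧
      (∀ f g, ε f g = ε₁ f g + ε₂ f g) ∧
      (IsSymmForm ε₁ ∧ IsLowerSemibounded ε₁ ∧ IsClosedForm ε₁) ∧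
      ¬ IsSymmForm ε₂ ∧
      (IsBoundedForm ε₂ ∧ (∀ f, |ε₂ f f| ≤ C * ‖f‖ ^ 2) ∧ ∀ f, c * ‖f‖ ^ 2 ≤ |ε₂ f f|) ∧
      ∃ L₁ L₂ : H1 a b →L[ℝ] H1 a b, IsSelfAdjoint L₁ ∧
        (∀ f g, ε₁ f g = inner ℝ (L₁ f) g) ∧
        (∀ f g, ε₂ f g = inner ℝ (L₂ f) g) ∧
        ∀ f g, ε f g = inner ℝ ((L₁ + L₂) f) g := by

  have hd : 0 < b - a + 1 := by linarith
  -- Both constants come from `|ε₂ f f| = ‖f'‖² / 2`: the lower one from `‖f‖ ≤ (b - a + 1) ‖f'‖`,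
  -- the upper one from `‖f'‖ ≤ ‖f‖`.
  refine ⟨1 / (2 * (b - a + 1) ^ 2), 1 / 2, by positivity, by norm_num, ?_⟩
  filter_upwards [hW.cont, hW.ae_sub_ne_zero hab] with ω hw hne
  rintro _ _ _ rfl rfl rfl
  obtain ⟨x, hx, hwx⟩ := hw.exists_mem_Ioo_ne_zero hab hne
  have h1 := H1.formE1_eq_inner hab.le hw
  have h2 := H1.formE2_eq_inner hab.le hw
  have h (f g : H1 a b) : formE (fun t => W t ω) f g
      = inner ℝ ((H1.opE1 hab.le hw + H1.opE2 hab.le hw) f) g := by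
    rw [H1.formE_eq_add, h1, h2, add_apply, inner_add_left]
  refine ⟨⟨isBilinearMap_of_eq_inner h, isBilinearMap_of_eq_inner h1,
    isBilinearMap_of_eq_inner h2⟩, H1.formE_eq_add _, ⟨H1.isSymmForm_formE1 _,
    isLowerSemibounded_of_eq_inner h1, isClosedForm_of_eq_inner h1⟩,
    H1.not_isSymmForm_formE2 hw hx hwx, ⟨⟨_, abs_le_of_eq_inner h2⟩, fun f => ?_, fun f => ?_⟩,
    _, _, H1.isSelfAdjoint_opE1 hab.le hw, h1, h2, h⟩
  · rw [H1.abs_formE2_self hab.le]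
    gcongr
    exact H1.norm_derivL2_le hab.le f
  · rw [H1.abs_formE2_self hab.le, div_mul_eq_mul_div, div_le_iff₀ (by positivity)]
    have := pow_le_pow_left₀ (norm_nonneg _) (H1.norm_le_derivL2 hab.le f) 2
    rw [mul_pow] at this
    linarith
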